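/- Let $n\ge 0$ and $a\in[0,1]^n$. Let $P(a)=\{x\in[0,1]^n : \sum_i a_i x_i\le 1\}$ be the fractional knapsack polytope and let $P_I(a)=\mathrm{conv}(P(a)\cap\{0,1\}^n)$. A contention resolution scheme (CRS) for $P(a)$ is a (possibly randomized) procedure that, given $x\in P(a)$ and $R\subseteq\mathrm{supp}(x)$, returns a (random) point $y_x^R\in P_I(a)$ with $\mathrm{supp}(y_x^R)\subseteq R$. It is monotone if $\mathbb{E}[(y_x^A)_i]\ge\mathbb{E}[(y_x^B)_i]$ for all $x\in P(a)$ and $i\in A\subseteq B\subseteq\mathrm{supp}(x)$. It is $c$-balanced if $\mathbb{E}[(y_x^R)_j\mid j\in R]\ge c$ for all $x\in P(a)$ and $j\in\mathrm{supp}(x)$, where the random set $R$ contains each item $i$ independently with probability $x_i$, and the expectation is over $R$ and the randomness of the scheme. Write $a(R)=\sum_{i\in R}a_i$ and let $\chi^R$ be the characteristic vector of $R$. The general scheme returns $\chi^R$ if $a(R)\le 1$, and $\frac{\chi^R}{2a(R)}$ otherwise. The Poisson scheme draws, independently for the items $i\in R$, a count $q_i$: with probability $\frac{1-e^{-x_i}}{x_i}$,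 $q_i$ is a $\mathrm{Pois}(x_i)$ variable conditioned on being at least $1$, and otherwise $q_i=0$; it returns the point $y$ with $y_i=q_i/\sum_{j\in R}q_j$ for $i\in R$ with $q_i>0$, and $y_i=0$ for all other $i$. The mixed scheme runs, with probability $q=\frac{6(e^2-1)}{7e^2-6}\in(0,1)$, the general scheme on $R$, and otherwise the Poisson scheme on $\{i\in R : \frac12<a_i\le 1\}$. Then, for every $n$ and every $a\in[0,1]^n$, there exists a monotone $0.279$-balanced contention resolution scheme for $P(a)$. More precisely, the mixed scheme is a monotone $\frac{2(e^2-1)}{7e^2-6}$-balanced contention resolution scheme for $P(a)$, and $\frac{2(e^2-1)}{7e^2-6}\ge 0.279$. Moreover, the general scheme satisfies $\mathbb{E}[(y_x^R)_j\mid j\in R]\ge\frac13$ for all $x\in P(a)$ and all $j\in\mathrm{supp}(x)$ with $a_j\le\frac12$. -/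

import Mathlib

open MeasureTheory ProbabilityTheory

noncomputable section

namespace ContentionResolution

/-- The support of `x`, i.e. the set of indices `i` with `x i ≠ 0`. -/
def supp {n : ℕ} (x : Fin n → ℝ) : Finset (Fin n) :=
  Finset.univ.filter (fun i => x i ≠ 0)

/-- The characteristic vector of `R`. -/
def charVec {n : ℕ} (R : Finset (Fin n)) : Fin n → ℝ :=
  fun i => if i ∈ R then 1 else 0

/-- The integer hull of `P ⊆ [0,1]^n`: the convex hull of the 0/1-points of `P`. -/
def integerHull {n : ℕ} (P : Set (Fin n → ℝ)) : Set (Fin n → ℝ) :=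
  convexHull ℝ {z | z ∈ P ∧ ∀ i, z i = 0 ∨ z i = 1}

/-- A (randomized) procedure that receives a point `x` and a set `R` and returns a random point
of `ℝ^n`; it is given by the law of the returned point. -/
abbrev Scheme (n : ℕ) : Type :=
  (Fin n → ℝ) → Finset (Fin n) → Measure (Fin n → ℝ)

/-- The probability that the random set which contains each `i` independently with
probability `x i` is equal to `R`. -/
def sampleProb {n : ℕ} (x : Fin n → ℝ) (R : Finset (Fin n)) : ℝ :=
  (∏ i ∈ R, x i) * ∏ i ∈ Rᶜ, (1 - x i)

/-- `E[(y_x^A)_j]`, the expectation being over the randomness of the scheme. -/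
def expectedCoord {n : ℕ} (π : Scheme n) (x : Fin n → ℝ) (A : Finset (Fin n)) (j : Fin n) : ℝ :=
  ∫ y, y j ∂(π x A)

/-- `E[(y_x^R)_j | j ∈ R]`, where `R` contains each `i` independently with probability `x i`, and
the expectation is over `R` and the randomness of the scheme. -/
def condExpectedCoord {n : ℕ} (π : Scheme n) (x : Fin n → ℝ) (j : Fin n) : ℝ :=
  (∑ R with j ∈ R, sampleProb x R * expectedCoord π x R j) / ∑ R with j ∈ R, sampleProb x R

/-- `π` is a contention resolution scheme for `P`: given `x ∈ P` and `R ⊆ supp x`, it returns a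
point of the integer hull of `P` whose support is contained in `R`. -/
def IsCRS {n : ℕ} (P : Set (Fin n → ℝ)) (π : Scheme n) : Prop :=
  ∀ x ∈ P, ∀ R ⊆ supp x, IsProbabilityMeasure (π x R) ∧
    ∀ᵐ y ∂(π x R), y ∈ integerHull P ∧ supp y ⊆ R

/-- `π` is monotone. -/
def IsMonotone {n : ℕ} (P : Set (Fin n → ℝ)) (π : Scheme n) : Prop :=
  ∀ x ∈ P, ∀ A B : Finset (Fin n), A ⊆ B → B ⊆ supp x → ∀ i ∈ A,
    expectedCoord π x B i ≤ expectedCoord π x A i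

/-- `π` is `c`-balanced. -/
def IsBalanced {n : ℕ} (P : Set (Fin n → ℝ)) (π : Scheme n) (c : ℝ) : Prop :=
  ∀ x ∈ P, ∀ j ∈ supp x, c ≤ condExpectedCoord π x j

/-- The fractional knapsack polytope with item sizes `a` and capacity `1`. -/
def knapsackPolytope {n : ℕ} (a : Fin n → ℝ) : Set (Fin n → ℝ) :=
  {x | (∀ i, 0 ≤ x i ∧ x i ≤ 1) ∧ ∑ i, a i * x i ≤ 1}

/-- The point `χ^R` if `a(R) ≤ 1`, and `χ^R / (2 a(R))` otherwise. -/
def generalPoint {n : ℕ} (a : Fin n → ℝ) (R : Finset (Fin n)) : Fin n → ℝ :=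
  if ∑ i ∈ R, a i ≤ 1 then charVec R else (1 / (2 * ∑ i ∈ R, a i)) • charVec R

/-- The (deterministic) general scheme. -/
def generalScheme {n : ℕ} (a : Fin n → ℝ) : Scheme n :=
  fun _ R => Measure.dirac (generalPoint a R)

/-- The law of the count `q_i` of an item `i ∈ R` with `x i = t > 0`: with probability
`(1 - e^{-t}) / t` the item is sampled, and then `q_i` is a `Pois(t)` variable conditioned on being
at least `1`; otherwise `q_i = 0`. -/
def countLaw (t : ℝ) : Measure ℕ :=
  ENNReal.ofReal ((1 - Real.exp (-t)) / t) • (poissonMeasure t.toNNReal)[|{k : ℕ | 1 ≤ k}]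
    + ENNReal.ofReal (1 - (1 - Real.exp (-t)) / t) • Measure.dirac 0

/-- The Poisson scheme: the counts `q_i` are independent, `q_i = 0` for `i ∉ R`, and the returned
point is `y_i = q_i / ∑_{j ∈ R} q_j` (the zero vector if all the counts vanish). -/
def poissonScheme (n : ℕ) : Scheme n :=
  fun x R =>
    (Measure.pi (fun i => if i ∈ R then countLaw (x i) else Measure.dirac 0)).map
      (fun q : Fin n → ℕ => fun i => (q i : ℝ) / ∑ j ∈ R, (q j : ℝ))

/-- The class-1 (big) items of `R`, i.e. those of size in `(1/2, 1]`. -/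
def bigItems {n : ℕ} (a : Fin n → ℝ) (R : Finset (Fin n)) : Finset (Fin n) :=
  R.filter (fun i => 1 / 2 < a i ∧ a i ≤ 1)

/-- With probability `q` run the general scheme on `R`, and otherwise run the Poisson scheme on the
class-1 items of `R`. -/
def mixedScheme {n : ℕ} (q : ℝ) (a : Fin n → ℝ) : Scheme n :=
  fun x R => ENNReal.ofReal q • generalScheme a x R
    + ENNReal.ofReal (1 - q) • poissonScheme n x (bigItems a R)

/-- The mixing probability. -/
def mixProb : ℝ := 6 * (Real.exp 1 ^ 2 - 1) / (7 * Real.exp 1 ^ 2 - 6)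

/-- The balancedness constant. -/
def mixBalance : ℝ := 2 * (Real.exp 1 ^ 2 - 1) / (7 * Real.exp 1 ^ 2 - 6)

end ContentionResolution

end

noncomputable section

namespace ContentionResolution

variable {n : ℕ}

/-! Feasibility of the general scheme rests on the fact that half of any point of `P(a)` lies in
`P_I(a)` (`half_smul_mem_integerHull`). An extreme point has at most one fractional coordinate, so
it is the sum of its integral part and a multiple of a unit vector, both in `P_I(a)`. The midpoint
of these two is half the extreme point, and Krein–Milman extends this to all of `P(a)`. The Poisson
scheme returns subconvex combinations of unit vectors, feasible because every item fits alone.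

For balancedness of the general scheme, replace `1 / (2 s)` by its tangent at `c ≥ 1`. Given `j ∈
R`, the expected size of `R` is at most `1 + a j`. If this is at most `c`, then item `j` receives at
least `1 / (2c)`: `1/3` for small items (`c = 3/2`) and `1/4` in general (`c = 2`).

In the Poisson scheme, sampling `R` and then drawing counts makes the counts independent Poisson
variables with rates `x i` (`smul_countLaw_add_smul_dirac`). Writing `q_j / N` as `∫₀¹ q_j s^(N-1)
ds`, where `N` is the total count, factorizes the expected share into generating functions. Big
items have total rate at most `2`, which yields the factor `(1 - e⁻²) / 2`.

The mixing probability equalizes the guarantees for small and big items. Monotonicity holds for each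
scheme separately, by a coupling in the Poisson case. -/

theorem mem_supp {x : Fin n → ℝ} {i : Fin n} : i ∈ supp x ↔ x i ≠ 0 := by
  simp [supp]

/-! ### The integer hull of a knapsack polytope -/

theorem convex_knapsackPolytope (a : Fin n → ℝ) : Convex ℝ (knapsackPolytope a) := by
  intro x hx y hy s t hs ht hst
  refine ⟨fun i => ⟨?_, ?_⟩, ?_⟩
  · have := (hx.1 i).1
    have := (hy.1 i).1
    simp only [Pi.add_apply, Pi.smul_apply, smul_eq_mul]
    positivity
  · have h1 := mul_le_mul_of_nonneg_left (hx.1 i).2 hs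
    have h2 := mul_le_mul_of_nonneg_left (hy.1 i).2 ht
    simp only [Pi.add_apply, Pi.smul_apply, smul_eq_mul]
    linarith
  · have h1 := mul_le_mul_of_nonneg_left hx.2 hs
    have h2 := mul_le_mul_of_nonneg_left hy.2 ht
    have : ∑ i, a i * (s • x + t • y) i = s * ∑ i, a i * x i + t * ∑ i, a i * y i := by
      rw [Finset.mul_sum, Finset.mul_sum, ← Finset.sum_add_distrib]
      refine Finset.sum_congr rfl fun i _ => ?_
      simp only [Pi.add_apply, Pi.smul_apply, smul_eq_mul]
      ring
    linarith

theorem isCompact_knapsackPolytope (a : Fin n → ℝ) : IsCompact (knapsackPolytope a) := by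
  have h : knapsackPolytope a = Set.Icc 0 1 ∩ {x | ∑ i, a i * x i ≤ 1} := by
    ext x
    simp only [knapsackPolytope, Set.mem_inter_iff, Set.mem_Icc, Set.mem_ofPred_eq, Pi.le_def,
      Pi.zero_apply, Pi.one_apply, forall_and]
  rw [h]
  exact isCompact_Icc.inter_right (isClosed_le (by fun_prop) (by fun_prop))

theorem finite_binary (P : Set (Fin n → ℝ)) : {z | z ∈ P ∧ ∀ i, z i = 0 ∨ z i = 1}.Finite := by
  refine (Set.Finite.pi' (t := fun _ : Fin n => ({0, 1} : Set ℝ))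
    fun _ => Set.toFinite _).subset fun z hz i => ?_
  simpa using hz.2 i

theorem isClosed_integerHull (P : Set (Fin n → ℝ)) : IsClosed (integerHull P) :=
  (finite_binary P).isClosed_convexHull ℝ

theorem binary_mem_integerHull {P : Set (Fin n → ℝ)} {z : Fin n → ℝ} (hz : z ∈ P)
    (h : ∀ i, z i = 0 ∨ z i = 1) : z ∈ integerHull P :=
  subset_convexHull ℝ _ ⟨hz, h⟩

theorem zero_mem_knapsackPolytope (a : Fin n → ℝ) : (0 : Fin n → ℝ) ∈ knapsackPolytope a := by
  simp [knapsackPolytope]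

theorem zero_mem_integerHull (a : Fin n → ℝ) :
    (0 : Fin n → ℝ) ∈ integerHull (knapsackPolytope a) :=
  binary_mem_integerHull (zero_mem_knapsackPolytope a) (by simp)

theorem single_mem_integerHull {a : Fin n → ℝ} (ha : ∀ i, a i ≤ 1) (k : Fin n) :
    (Pi.single k 1 : Fin n → ℝ) ∈ integerHull (knapsackPolytope a) := by
  refine binary_mem_integerHull ⟨fun i => ?_, ?_⟩ fun i => ?_
  · rcases eq_or_ne i k with rfl | h <;> simp [*]
  · simpa [Pi.single_apply] using ha k
  · rcases eq_or_ne i k with rfl | h <;> simp [*]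

/-- Convex combinations of unit vectors and `0` lie in the integer hull. -/
theorem mem_integerHull_of_sum_le_one {a : Fin n → ℝ} (ha : ∀ i, a i ≤ 1) {y : Fin n → ℝ}
    (hy : ∀ i, 0 ≤ y i) (hsum : ∑ i, y i ≤ 1) : y ∈ integerHull (knapsackPolytope a) := by
  have h := (convex_convexHull ℝ {z | z ∈ knapsackPolytope a ∧ ∀ i, z i = 0 ∨ z i = 1}).sum_mem
    (t := Finset.univ) (w := fun o : Option (Fin n) => o.elim (1 - ∑ i, y i) y)
    (z := fun o : Option (Fin n) => o.elim 0 fun i => Pi.single i 1)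
    (by rintro (_ | i) _ <;> simp [*]) (by simp [Fintype.sum_option])
    (by
      rintro (_ | i) _
      · exact zero_mem_integerHull a
      · exact single_mem_integerHull ha i)
  have hy' : ∑ o : Option (Fin n), (o.elim (1 - ∑ i, y i) y : ℝ) •
      (o.elim 0 fun i => Pi.single i 1 : Fin n → ℝ) = y := by
    ext k
    simp [Fintype.sum_option, Pi.single_apply]
  rwa [hy'] at h

/-- An extreme point of a knapsack polytope has at most one fractional coordinate. -/
theorem fractional_unique_of_mem_extremePoints {a : Fin n → ℝ} {x : Fin n → ℝ}
    (hx : x ∈ (knapsackPolytope a).extremePoints ℝ) {i j : Fin n}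
    (hi : 0 < x i ∧ x i < 1) (hj : 0 < x j ∧ x j < 1) : i = j := by
  by_contra hij
  -- A direction supported on `i` and `j` and orthogonal to `a`: moving along `±d` leaves the total
  -- size unchanged, and small moves respect the bounds because both coordinates are fractional.
  obtain ⟨d, hd0, hd, hda⟩ : ∃ d : Fin n → ℝ, d ≠ 0 ∧ (∀ k, k ≠ i → k ≠ j → d k = 0) ∧
      ∑ k, a k * d k = 0 := by
    by_cases hai : a i = 0
    · refine ⟨Pi.single i 1, by simp, fun k hk _ => by simp [hk], by simp [Pi.single_apply, hai]⟩
    · refine ⟨Pi.single i (a j) - Pi.single j (a i), fun h => hai ?_, fun k hk hk' => by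
        simp [hk, hk'], ?_⟩
      · simpa [hij, Ne.symm hij] using congrFun h j
      · simp only [Pi.sub_apply, mul_sub, Finset.sum_sub_distrib]
        simp [Pi.single_apply, mul_comm]
  obtain ⟨ε, hε, h1, h2, h3, h4⟩ : ∃ ε : ℝ, 0 < ε ∧ ε * |d i| ≤ x i ∧ ε * |d i| ≤ 1 - x i ∧
      ε * |d j| ≤ x j ∧ ε * |d j| ≤ 1 - x j := by
    have key : ∀ (t u : ℝ), 0 < t → ∀ᶠ ε in nhdsWithin (0 : ℝ) (Set.Ioi 0), ε * |u| ≤ t := by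
      intro t u ht
      have : Filter.Tendsto (fun ε : ℝ => ε * |u|) (nhdsWithin 0 (Set.Ioi 0)) (nhds 0) := by
        have h : Filter.Tendsto (fun ε : ℝ => ε * |u|) (nhds 0) (nhds (0 * |u|)) :=
          (continuous_id.mul continuous_const).tendsto 0
        rw [zero_mul] at h
        exact h.mono_left nhdsWithin_le_nhds
      exact (this.eventually_lt_const ht).mono fun _ h => h.le
    obtain ⟨ε, h⟩ := (eventually_mem_nhdsWithin.and ((key _ (d i) hi.1).and
      ((key _ (d i) (sub_pos.2 hi.2)).and ((key _ (d j) hj.1).and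
        (key _ (d j) (sub_pos.2 hj.2)))))).exists
    exact ⟨ε, h.1, h.2.1, h.2.2.1, h.2.2.2.1, h.2.2.2.2⟩
  have hmem : ∀ σ : ℝ, |σ| ≤ ε → x + σ • d ∈ knapsackPolytope a := by
    intro σ hσ
    refine ⟨fun k => ?_, ?_⟩
    · have hb : |σ * d k| ≤ ε * |d k| := by
        rw [abs_mul]; exact mul_le_mul_of_nonneg_right hσ (abs_nonneg _)
      rw [abs_le] at hb
      simp only [Pi.add_apply, Pi.smul_apply, smul_eq_mul]
      by_cases hki : k = i
      · subst hki; constructor <;> linarith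
      by_cases hkj : k = j
      · subst hkj; constructor <;> linarith
      simpa [hd k hki hkj] using hx.1.1 k
    · have : ∑ k, a k * (x + σ • d) k = ∑ k, a k * x k + σ * ∑ k, a k * d k := by
        rw [Finset.mul_sum, ← Finset.sum_add_distrib]
        refine Finset.sum_congr rfl fun k _ => ?_
        simp only [Pi.add_apply, Pi.smul_apply, smul_eq_mul]
        ring
      rw [this, hda, mul_zero, add_zero]
      exact hx.1.2
  have hseg : x ∈ openSegment ℝ (x + ε • d) (x + (-ε) • d) :=
    ⟨1 / 2, 1 / 2, by norm_num, by norm_num, by norm_num, by ext k; simp; ring⟩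
  have := hx.2 (hmem ε (abs_of_pos hε).le) (hmem (-ε) (by rw [abs_neg, abs_of_pos hε])) hseg
  have : ε • d = 0 := by simpa using this
  exact hd0 ((smul_eq_zero.1 this).resolve_left hε.ne')

/-- Half of a point of the knapsack polytope lies in the integer hull. -/
theorem half_smul_mem_integerHull {a : Fin n → ℝ} (ha : ∀ i, 0 ≤ a i ∧ a i ≤ 1) {x : Fin n → ℝ}
    (hx : x ∈ knapsackPolytope a) : (1 / 2 : ℝ) • x ∈ integerHull (knapsackPolytope a) := by
  have hconv : Convex ℝ (integerHull (knapsackPolytope a)) := convex_convexHull ℝ _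
  -- The set on the right is closed and convex, so only the extreme points need checking.
  have hsub : closure (convexHull ℝ ((knapsackPolytope a).extremePoints ℝ)) ⊆
      {x | (1 / 2 : ℝ) • x ∈ integerHull (knapsackPolytope a)} := by
    refine closure_minimal (convexHull_min ?_ ?_) ?_
    · intro z hz
      set r : Fin n → ℝ := fun i => if z i = 1 then 1 else 0
      set f : Fin n → ℝ := fun i => if z i = 1 then 0 else z i
      have hzr : z = r + f := by ext i; simp only [r, f, Pi.add_apply]; split_ifs <;> simp [*]
      have hr : r ∈ integerHull (knapsackPolytope a) := by
        refine binary_mem_integerHull ⟨fun i => ?_, ?_⟩ fun i => ?_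
        · simp only [r]; split_ifs <;> simp
        · refine (Finset.sum_le_sum fun i _ => ?_).trans hz.1.2
          refine mul_le_mul_of_nonneg_left ?_ (ha i).1
          simp only [r]; split_ifs with h
          · exact h.ge
          · exact (hz.1.1 i).1
        · simp only [r]; split_ifs <;> simp
      have hf : f ∈ integerHull (knapsackPolytope a) := by
        have hf0 : ∀ i, 0 ≤ f i := fun i => by
          simp only [f]; split_ifs
          · exact le_rfl
          · exact (hz.1.1 i).1
        refine mem_integerHull_of_sum_le_one (fun i => (ha i).2) hf0 ?_
        by_cases hall : ∀ i, f i = 0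
        · simp [hall]
        push Not at hall
        obtain ⟨i, hi⟩ := hall
        have frac : ∀ k, f k ≠ 0 → 0 < z k ∧ z k < 1 := by
          intro k hk
          simp only [f, ne_eq, ite_eq_left_iff, Classical.not_imp] at hk
          exact ⟨lt_of_le_of_ne (hz.1.1 k).1 (Ne.symm hk.2), lt_of_le_of_ne (hz.1.1 k).2 hk.1⟩
        rw [Finset.sum_eq_single i (fun k _ hk => by
          by_contra h
          exact hk (fractional_unique_of_mem_extremePoints hz (frac k h) (frac i hi))) (by simp)]
        simp only [f]; split_ifs
        · exact zero_le_one
        · exact (hz.1.1 i).2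
      rw [Set.mem_ofPred_eq, hzr, smul_add]
      exact hconv hr hf (by norm_num) (by norm_num) (by norm_num)
    · exact hconv.is_linear_preimage (IsLinearMap.isLinearMap_smul (1 / 2 : ℝ))
    · exact (isClosed_integerHull _).preimage (continuous_const_smul (1 / 2 : ℝ))
  rw [closure_convexHull_extremePoints (isCompact_knapsackPolytope a)
    (convex_knapsackPolytope a)] at hsub
  exact hsub hx

/-! ### The general scheme -/

theorem sum_mul_charVec (a : Fin n → ℝ) (R : Finset (Fin n)) :
    ∑ i, a i * charVec R i = ∑ i ∈ R, a i := by
  simp [charVec]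

theorem generalPoint_mem_integerHull {a : Fin n → ℝ} (ha : ∀ i, 0 ≤ a i ∧ a i ≤ 1)
    (R : Finset (Fin n)) : generalPoint a R ∈ integerHull (knapsackPolytope a) := by
  unfold generalPoint
  split_ifs with h
  · refine binary_mem_integerHull ⟨fun i => ?_, (sum_mul_charVec a R).trans_le h⟩ fun i => ?_
    · simp only [charVec]; split_ifs <;> simp
    · simp only [charVec]; split_ifs <;> simp
  · push Not at h
    have hpos : 0 < ∑ i ∈ R, a i := by linarith
    -- Scaling `χ^R` to total size exactly `1` gives a point of the polytope; the factor `1/2` in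
    -- the scheme is the price of integrality.
    have hmem : (∑ i ∈ R, a i)⁻¹ • charVec R ∈ knapsackPolytope a := by
      refine ⟨fun i => ?_, ?_⟩
      · simp only [Pi.smul_apply, charVec, smul_eq_mul]
        split_ifs
        · exact ⟨by positivity, by simpa using inv_le_one_of_one_le₀ h.le⟩
        · simp
      · have : ∑ i, a i * ((∑ i ∈ R, a i)⁻¹ • charVec R) i
            = (∑ i ∈ R, a i)⁻¹ * ∑ i, a i * charVec R i := by
          rw [Finset.mul_sum]
          exact Finset.sum_congr rfl fun i _ => by
            simp only [Pi.smul_apply, smul_eq_mul]; ring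
        rw [this, sum_mul_charVec, inv_mul_cancel₀ hpos.ne']
    have := half_smul_mem_integerHull ha hmem
    rwa [smul_smul, one_div, ← mul_inv, ← one_div] at this

theorem supp_generalPoint (a : Fin n → ℝ) (R : Finset (Fin n)) : supp (generalPoint a R) ⊆ R := by
  intro i hi
  by_contra h
  refine mem_supp.1 hi ?_
  unfold generalPoint
  split_ifs <;> simp [charVec, h]

theorem expectedCoord_generalScheme (a x : Fin n → ℝ) (R : Finset (Fin n)) (j : Fin n) :
    expectedCoord (generalScheme a) x R j = generalPoint a R j := by
  simp [expectedCoord, generalScheme]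

theorem generalPoint_apply_of_mem {a : Fin n → ℝ} {R : Finset (Fin n)} {j : Fin n} (hj : j ∈ R) :
    generalPoint a R j = if ∑ i ∈ R, a i ≤ 1 then 1 else 1 / (2 * ∑ i ∈ R, a i) := by
  unfold generalPoint
  split_ifs <;> simp [charVec, hj]

theorem generalPoint_anti {a : Fin n → ℝ} (ha : ∀ i, 0 ≤ a i) {A B : Finset (Fin n)} (hAB : A ⊆ B)
    {i : Fin n} (hi : i ∈ A) : generalPoint a B i ≤ generalPoint a A i := by
  rw [generalPoint_apply_of_mem hi, generalPoint_apply_of_mem (hAB hi)]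
  have hle : ∑ i ∈ A, a i ≤ ∑ i ∈ B, a i :=
    Finset.sum_le_sum_of_subset_of_nonneg hAB fun i _ _ => ha i
  split_ifs with h1 h2 h2
  · exact le_rfl
  · linarith
  · rw [div_le_one (by linarith)]; linarith
  · exact one_div_le_one_div_of_le (by linarith) (by linarith)

/-- The tangent of `1 / (2 s)` at `s = c` bounds the general scheme from below. -/
theorem tangent_le_generalPoint {a : Fin n → ℝ} (ha : ∀ i, 0 ≤ a i) {c : ℝ} (hc : 1 ≤ c)
    {R : Finset (Fin n)} {j : Fin n} (hj : j ∈ R) :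
    1 / c - 1 / (2 * c ^ 2) * ∑ i ∈ R, a i ≤ generalPoint a R j := by
  rw [generalPoint_apply_of_mem hj]
  have h0 : 0 ≤ ∑ i ∈ R, a i := Finset.sum_nonneg fun i _ => ha i
  have hc0 : 0 < c := by linarith
  split_ifs with h
  · have h1 : 1 / c ≤ 1 := by rw [div_le_one hc0]; exact hc
    have h2 : 0 ≤ 1 / (2 * c ^ 2) * ∑ i ∈ R, a i := by positivity
    linarith
  · push Not at h
    generalize ∑ i ∈ R, a i = s at h h0
    have hs : 0 < s := by linarith
    have : 1 / (2 * s) - (1 / c - 1 / (2 * c ^ 2) * s) = (s - c) ^ 2 / (2 * s * c ^ 2) := by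
      field_simp; ring
    have h3 : 0 ≤ (s - c) ^ 2 / (2 * s * c ^ 2) := by positivity
    linarith

/-! ### The random set -/

theorem sampleProb_nonneg {x : Fin n → ℝ} (hx : ∀ i, 0 ≤ x i ∧ x i ≤ 1) (R : Finset (Fin n)) :
    0 ≤ sampleProb x R :=
  mul_nonneg (Finset.prod_nonneg fun i _ => (hx i).1)
    (Finset.prod_nonneg fun i _ => sub_nonneg.2 (hx i).2)

/-- Expand `∏ (x i + (1 - x i))` with the second summand replaced by `0` on `T`: exactly the terms
with `T ⊆ R` survive. -/
theorem sum_sampleProb_superset (x : Fin n → ℝ) (T : Finset (Fin n)) :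
    ∑ R with T ⊆ R, sampleProb x R = ∏ i ∈ T, x i := by
  have h := Fintype.prod_add x fun i => if i ∈ T then 0 else 1 - x i
  have h1 : ∏ i, (x i + if i ∈ T then 0 else 1 - x i) = ∏ i ∈ T, x i := by
    rw [← Finset.prod_subset (Finset.subset_univ T) (fun i _ hi => by simp [hi])]
    exact Finset.prod_congr rfl fun i hi => by simp [hi]
  rw [← h1, h, Finset.sum_filter]
  refine Finset.sum_congr rfl fun R _ => ?_
  split_ifs with hT
  · unfold sampleProb
    congr 1
    refine Finset.prod_congr rfl fun i hi => ?_
    rw [if_neg fun h => Finset.mem_compl.1 hi (hT h)]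
  · obtain ⟨i, hiT, hiR⟩ := Finset.not_subset.1 hT
    rw [Finset.prod_eq_zero (i := i) (Finset.mem_compl.2 hiR) (by simp [hiT]), mul_zero]

theorem sum_sampleProb_mem (x : Fin n → ℝ) (j : Fin n) :
    ∑ R with j ∈ R, sampleProb x R = x j := by
  simpa using sum_sampleProb_superset x {j}

theorem sum_sampleProb_mem_mem (x : Fin n → ℝ) {i j : Fin n} (hij : i ≠ j) :
    ∑ R with i ∈ R ∧ j ∈ R, sampleProb x R = x i * x j := by
  have := sum_sampleProb_superset x {i, j}
  rwa [Finset.prod_pair hij, Finset.filter_congr (q := fun R => i ∈ R ∧ j ∈ R)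
    (by simp [Finset.insert_subset_iff])] at this

/-- Conditioned on `j ∈ R`, the expected size of `R` is at most `1 + a j`. -/
theorem sum_sampleProb_mul_size_le {a x : Fin n → ℝ} (ha : ∀ i, 0 ≤ a i)
    (hx : x ∈ knapsackPolytope a) (j : Fin n) :
    ∑ R with j ∈ R, sampleProb x R * ∑ i ∈ R, a i ≤ x j * (1 + a j) := by
  have h1 : ∑ R with j ∈ R, sampleProb x R * ∑ i ∈ R, a i
      = ∑ i, a i * ∑ R with i ∈ R ∧ j ∈ R, sampleProb x R := by
    simp_rw [Finset.mul_sum, Finset.sum_filter]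
    rw [Finset.sum_comm]
    refine Finset.sum_congr rfl fun R _ => ?_
    by_cases hj : j ∈ R
    · simp only [hj, if_true, and_true]
      rw [← Finset.sum_filter, Finset.filter_mem_eq_inter, Finset.univ_inter]
      exact Finset.sum_congr rfl fun i _ => mul_comm _ _
    · simp [hj]
  have h2 : ∀ i, a i * ∑ R with i ∈ R ∧ j ∈ R, sampleProb x R
      ≤ x j * (a i * x i) + if i = j then x j * a j else 0 := by
    intro i
    split_ifs with h
    · subst h
      simp only [and_self, sum_sampleProb_mem]
      have := mul_nonneg (hx.1 i).1 (mul_nonneg (ha i) (hx.1 i).1)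
      linarith
    · rw [sum_sampleProb_mem_mem x h]
      linarith
  rw [h1]
  refine (Finset.sum_le_sum fun i _ => h2 i).trans ?_
  rw [Finset.sum_add_distrib, ← Finset.mul_sum, Finset.sum_ite_eq' Finset.univ j]
  have := mul_le_mul_of_nonneg_left hx.2 (hx.1 j).1
  simp only [Finset.mem_univ, if_true]
  linarith

/-- Clearing the denominator `P(j ∈ R) = x j` makes the condition linear in the scheme, so that
bounds for the two schemes can be mixed. -/
theorem le_condExpectedCoord_iff {π : Scheme n} {x : Fin n → ℝ} {j : Fin n} (hj : 0 < x j)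
    (c : ℝ) : c ≤ condExpectedCoord π x j ↔
      c * x j ≤ ∑ R with j ∈ R, sampleProb x R * expectedCoord π x R j := by
  rw [condExpectedCoord, sum_sampleProb_mem, le_div_iff₀ hj]

/-- The tangent bound is affine in the size of `R`, so only the expected size matters. Inserting the
bound `c` for it leaves `1/c - 1/(2c)`. -/
theorem half_inv_mul_le_sum_generalScheme {a x : Fin n → ℝ} (ha : ∀ i, 0 ≤ a i)
    (hx : x ∈ knapsackPolytope a) (j : Fin n) {c : ℝ} (hc : 1 ≤ c) (hac : 1 + a j ≤ c) :
    1 / (2 * c) * x j ≤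
      ∑ R with j ∈ R, sampleProb x R * expectedCoord (generalScheme a) x R j := by
  have hc0 : 0 < c := by linarith
  have h1 : ∑ R with j ∈ R, sampleProb x R * (1 / c - 1 / (2 * c ^ 2) * ∑ i ∈ R, a i) ≤
      ∑ R with j ∈ R, sampleProb x R * expectedCoord (generalScheme a) x R j := by
    refine Finset.sum_le_sum fun R hR => ?_
    rw [expectedCoord_generalScheme]
    exact mul_le_mul_of_nonneg_left (tangent_le_generalPoint ha hc (Finset.mem_filter.1 hR).2)
      (sampleProb_nonneg hx.1 R)
  refine le_trans ?_ h1
  have h2 : ∑ R with j ∈ R, sampleProb x R * (1 / c - 1 / (2 * c ^ 2) * ∑ i ∈ R, a i) =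
      1 / c * x j - 1 / (2 * c ^ 2) * ∑ R with j ∈ R, sampleProb x R * ∑ i ∈ R, a i := by
    rw [← sum_sampleProb_mem x j, Finset.mul_sum, Finset.mul_sum, ← Finset.sum_sub_distrib]
    exact Finset.sum_congr rfl fun R _ => by ring
  have h3 : 1 / (2 * c ^ 2) * ∑ R with j ∈ R, sampleProb x R * ∑ i ∈ R, a i ≤
      1 / (2 * c ^ 2) * (x j * c) :=
    mul_le_mul_of_nonneg_left ((sum_sampleProb_mul_size_le ha hx j).trans
      (mul_le_mul_of_nonneg_left hac (hx.1 j).1)) (by positivity)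
  have h4 : 1 / c * x j - 1 / (2 * c ^ 2) * (x j * c) = 1 / (2 * c) * x j := by
    field_simp; ring
  linarith

/-! ### The constants -/

theorem six_nine_lt_exp_sq : 6.9 < Real.exp 1 ^ 2 := by
  nlinarith [Real.exp_one_gt_d9]

theorem mixProb_pos : 0 < mixProb := by
  have := six_nine_lt_exp_sq
  exact div_pos (by linarith) (by linarith)

theorem mixProb_lt_one : mixProb < 1 := by
  have := six_nine_lt_exp_sq
  rw [mixProb, div_lt_one (by linarith)]
  linarith

theorem le_mixBalance : 0.279 ≤ mixBalance := by
  -- The claim amounts to `e² ≥ 0.326 / 0.047 ≈ 6.94`, so the earlier bound `6.9` falls just short.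
  have : 7.3 < Real.exp 1 ^ 2 := by nlinarith [Real.exp_one_gt_d9]
  rw [mixBalance, le_div_iff₀ (by linarith)]
  linarith

theorem mixBalance_eq : mixBalance = mixProb * (1 / 3) := by
  rw [mixBalance, mixProb]; ring

/-- The guarantee for big items; its agreement with `mixProb * (1 / 3)`, the one for small items, is
what determines `mixProb`. -/
theorem mixBalance_eq' :
    mixBalance = mixProb * (1 / 4) + (1 - mixProb) * ((1 - Real.exp (-2)) / 2) := by
  have := six_nine_lt_exp_sq
  have h : Real.exp (-2) = (Real.exp 1 ^ 2)⁻¹ := by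
    rw [Real.exp_neg, ← Real.exp_nat_mul]; norm_num
  rw [mixBalance, mixProb, h]
  have h1 : Real.exp 1 ^ 2 ≠ 0 := by positivity
  have h2 : 7 * Real.exp 1 ^ 2 - 6 ≠ 0 := by linarith
  generalize Real.exp 1 ^ 2 = t at *
  have h3 : 1 - 6 * (t - 1) / (7 * t - 6) = t / (7 * t - 6) := by
    rw [eq_div_iff h2, sub_mul, div_mul_cancel₀ _ h2]; ring
  have h4 : t / (7 * t - 6) * ((1 - t⁻¹) / 2) = (t - 1) / (7 * t - 6) / 2 := by
    rw [div_mul_div_comm, mul_sub, mul_inv_cancel₀ h1, mul_one, div_div]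
  rw [h3, h4]
  ring

/-! ### The law of the counts -/

theorem poissonMeasure_singleton_zero {t : ℝ} (ht : 0 ≤ t) :
    poissonMeasure t.toNNReal {0} = ENNReal.ofReal (Real.exp (-t)) := by
  simp [poissonMeasure_singleton, ht]

theorem setOf_one_le_eq_compl : {k : ℕ | 1 ≤ k} = {0}ᶜ := by
  ext k; simp [Nat.one_le_iff_ne_zero]

theorem poissonMeasure_one_le {t : ℝ} (ht : 0 ≤ t) :
    poissonMeasure t.toNNReal {k : ℕ | 1 ≤ k} = ENNReal.ofReal (1 - Real.exp (-t)) := by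
  rw [setOf_one_le_eq_compl, prob_compl_eq_one_sub (measurableSet_singleton 0),
    poissonMeasure_singleton_zero ht, ENNReal.ofReal_sub _ (Real.exp_pos _).le, ENNReal.ofReal_one]

theorem one_sub_exp_neg_div_mem_Icc {t : ℝ} (ht : 0 ≤ t) :
    (1 - Real.exp (-t)) / t ∈ Set.Icc (0 : ℝ) 1 := by
  have h1 : 0 ≤ 1 - Real.exp (-t) := by simpa using ht
  have h2 : 1 - Real.exp (-t) ≤ t := by linarith [Real.one_sub_le_exp_neg t]
  exact ⟨div_nonneg h1 ht, div_le_one_of_le₀ h2 ht⟩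

/-- Division by zero yields `0`, so the sampling probability vanishes and items outside the support
need no separate treatment. -/
theorem countLaw_zero : countLaw 0 = Measure.dirac 0 := by
  simp [countLaw]

theorem isProbabilityMeasure_mix {α : Type*} [MeasurableSpace α] {p : ℝ}
    (hp : p ∈ Set.Icc (0 : ℝ) 1)
    (μ ν : Measure α) [IsProbabilityMeasure μ] [IsProbabilityMeasure ν] :
    IsProbabilityMeasure (ENNReal.ofReal p • μ + ENNReal.ofReal (1 - p) • ν) := by
  refine ⟨?_⟩
  simp only [Measure.add_apply, Measure.smul_apply, measure_univ, smul_eq_mul, mul_one]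
  rw [← ENNReal.ofReal_add hp.1 (sub_nonneg.2 hp.2)]
  simp

theorem isProbabilityMeasure_countLaw {t : ℝ} (ht : 0 ≤ t) : IsProbabilityMeasure (countLaw t) := by
  rcases ht.eq_or_lt with rfl | hpos
  · rw [countLaw_zero]; infer_instance
  · have : IsProbabilityMeasure ((poissonMeasure t.toNNReal)[|{k : ℕ | 1 ≤ k}]) := by
      refine cond_isProbabilityMeasure ?_
      rw [poissonMeasure_one_le ht]
      simpa using hpos
    exact isProbabilityMeasure_mix (one_sub_exp_neg_div_mem_Icc ht) _ _

/-- An item that is sampled with probability `t` and then has count law `countLaw t` has a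
Poisson distributed count. -/
theorem smul_countLaw_add_smul_dirac {t : ℝ} (ht : 0 ≤ t) (ht1 : t ≤ 1) :
    ENNReal.ofReal t • countLaw t + ENNReal.ofReal (1 - t) • Measure.dirac 0 =
      poissonMeasure t.toNNReal := by
  rcases ht.eq_or_lt with rfl | hpos
  · rw [countLaw_zero]
    refine Measure.ext_of_singleton fun k => ?_
    rcases eq_or_ne k 0 with rfl | hk
    · simp [poissonMeasure_singleton]
    · simp [poissonMeasure_singleton, hk, Ne.symm hk]
  have hne : ENNReal.ofReal (1 - Real.exp (-t)) ≠ 0 := by simpa using hpos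
  have hI := one_sub_exp_neg_div_mem_Icc ht
  rw [countLaw, ProbabilityTheory.cond, poissonMeasure_one_le ht, smul_add, smul_smul, smul_smul, smul_smul, add_assoc,
    ← add_smul, ← ENNReal.ofReal_mul ht, ← ENNReal.ofReal_mul ht, mul_div_cancel₀ _ hpos.ne',
    ENNReal.mul_inv_cancel hne ENNReal.ofReal_ne_top, one_smul,
    ← ENNReal.ofReal_add (mul_nonneg ht (sub_nonneg.2 hI.2)) (sub_nonneg.2 ht1), mul_sub,
    mul_div_cancel₀ _ hpos.ne']
  -- The first term has become the Poisson law restricted to positive counts; the remaining mass at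
  -- `0` is `e⁻ᵗ`, exactly the missing atom.
  have h : t * 1 - (1 - Real.exp (-t)) + (1 - t) = Real.exp (-t) := by ring
  rw [h, ← poissonMeasure_singleton_zero ht, ← Measure.restrict_singleton, setOf_one_le_eq_compl,
    Measure.restrict_compl_add_restrict (measurableSet_singleton 0)]

/-! ### Product measures and the random set -/

/-- A mixture over independent choices of coordinates is a product of mixtures: on boxes this is the
expansion of a product of sums over subsets `R`. -/
theorem sum_sampleProb_smul_pi {x : Fin n → ℝ} (hx : ∀ i, 0 ≤ x i ∧ x i ≤ 1)
    (μ ν : Fin n → Measure ℕ) [∀ i, IsProbabilityMeasure (μ i)] [∀ i, IsProbabilityMeasure (ν i)] :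
    ∑ R, ENNReal.ofReal (sampleProb x R) • Measure.pi (fun i => if i ∈ R then μ i else ν i) =
      Measure.pi fun i => ENNReal.ofReal (x i) • μ i + ENNReal.ofReal (1 - x i) • ν i := by
  have hprob : ∀ i, IsProbabilityMeasure (ENNReal.ofReal (x i) • μ i +
      ENNReal.ofReal (1 - x i) • ν i) := fun i => isProbabilityMeasure_mix ⟨(hx i).1, (hx i).2⟩ _ _
  have hprob' : ∀ (R : Finset (Fin n)) i, IsProbabilityMeasure (if i ∈ R then μ i else ν i) := by
    intro R i; split_ifs <;> infer_instance
  refine (Measure.pi_eq fun s _ => ?_).symm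
  simp only [Measure.add_apply, Measure.smul_apply, smul_eq_mul]
  rw [Fintype.prod_add, Measure.finsetSum_apply]
  refine Finset.sum_congr rfl fun R _ => ?_
  rw [Measure.smul_apply, Measure.pi_pi, smul_eq_mul, sampleProb,
    ENNReal.ofReal_mul (Finset.prod_nonneg fun i _ => (hx i).1),
    ENNReal.ofReal_prod_of_nonneg (fun i _ => (hx i).1),
    ENNReal.ofReal_prod_of_nonneg (fun i _ => sub_nonneg.2 (hx i).2),
    Finset.prod_mul_distrib, Finset.prod_mul_distrib, ← Finset.prod_mul_prod_compl R]
  have h1 : ∏ i ∈ R, (if i ∈ R then μ i else ν i) (s i) = ∏ i ∈ R, μ i (s i) :=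
    Finset.prod_congr rfl fun i hi => by rw [if_pos hi]
  have h2 : ∏ i ∈ Rᶜ, (if i ∈ R then μ i else ν i) (s i) = ∏ i ∈ Rᶜ, ν i (s i) :=
    Finset.prod_congr rfl fun i hi => by rw [if_neg (Finset.mem_compl.1 hi)]
  rw [h1, h2]
  ring

/-! ### Poisson integrals -/

theorem hasSum_poisson_pow (r : NNReal) (s : ℝ) :
    HasSum (fun k : ℕ => Real.exp (-r) * (r : ℝ) ^ k / (k.factorial : ℝ) * s ^ k)
      (Real.exp (-(r * (1 - s)))) := by
  have h := (NormedSpace.expSeries_div_hasSum_exp ((r : ℝ) * s)).mul_left (Real.exp (-r))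
  rw [← Real.exp_eq_exp_ℝ, ← Real.exp_add] at h
  convert! h using 1
  · ext k; rw [mul_pow]; ring
  · congr 1; ring

theorem hasSum_poisson_mul_pow (r : NNReal) (s : ℝ) :
    HasSum (fun k : ℕ => Real.exp (-r) * (r : ℝ) ^ k / (k.factorial : ℝ) * (k * s ^ (k - 1)))
      (r * Real.exp (-(r * (1 - s)))) := by
  -- The term `k = 0` vanishes, and shifting the index cancels the factor `k` against the factorial.
  rw [← hasSum_nat_add_iff' 1]
  convert! (hasSum_poisson_pow r s).mul_left (r : ℝ) using 1
  · ext k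
    rw [Nat.factorial_succ, Nat.add_sub_cancel]
    push_cast
    have : (k.factorial : ℝ) ≠ 0 := by positivity
    field_simp
    ring
  · simp

theorem integral_poisson_pow (r : NNReal) (s : ℝ) :
    ∫ k, s ^ k ∂poissonMeasure r = Real.exp (-(r * (1 - s))) := by
  rw [integral_poissonMeasure]
  exact (hasSum_poisson_pow r s).tsum_eq

theorem integral_poisson_mul_pow (r : NNReal) (s : ℝ) :
    ∫ k, (k : ℝ) * s ^ (k - 1) ∂poissonMeasure r = r * Real.exp (-(r * (1 - s))) := by
  rw [integral_poissonMeasure]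
  exact (hasSum_poisson_mul_pow r s).tsum_eq

theorem integrable_natCast_poisson (r : NNReal) :
    Integrable (fun k : ℕ => (k : ℝ)) (poissonMeasure r) := by
  rw [integrable_poissonMeasure_iff]
  simpa using (hasSum_poisson_mul_pow r 1).summable

/-- Turns a ratio of counts into an integral of powers. For `N = 0` the hypothesis forces `k = 0`,
and both sides are `0`. -/
theorem integral_mul_pow_sub_one (k N : ℕ) (hkN : k ≤ N) :
    ∫ s in (0 : ℝ)..1, (k : ℝ) * s ^ (N - 1) = k / N := by
  rw [intervalIntegral.integral_const_mul, integral_pow]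
  rcases Nat.eq_zero_or_pos N with rfl | hN
  · simp [Nat.le_zero.1 hkN]
  · have : ((N - 1 : ℕ) : ℝ) + 1 = N := by
      rw [← Nat.cast_succ, Nat.succ_eq_add_one, Nat.sub_add_cancel hN]
    rw [this]
    simp [div_eq_mul_inv]

/-- Separates the coordinates so that the integral over the product measure factorizes. Truncated
subtraction is harmless: when `q j = 0` both sides vanish. -/
theorem prod_mul_pow_sub_one (q : Fin n → ℕ) (j : Fin n) (s : ℝ) :
    ∏ i, (if i = j then (q i : ℝ) * s ^ (q i - 1) else s ^ q i) =
      q j * s ^ (∑ i, q i - 1) := by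
  rw [← Finset.mul_prod_erase Finset.univ _ (Finset.mem_univ j), if_pos rfl,
    Finset.prod_congr rfl (g := fun i => s ^ q i) fun i hi => if_neg (Finset.ne_of_mem_erase hi),
    Finset.prod_pow_eq_pow_sum, ← Finset.add_sum_erase Finset.univ _ (Finset.mem_univ j)]
  rcases Nat.eq_zero_or_pos (q j) with h | h
  · simp [h]
  · rw [mul_assoc, ← pow_add, Nat.sub_add_comm h]

/-- The expected share of `j` when all the counts are independent Poisson variables. -/
theorem integral_share_pi_poisson (r : Fin n → NNReal) (j : Fin n) :
    ∫ q : Fin n → ℕ, (q j : ℝ) / ∑ i, (q i : ℝ) ∂Measure.pi (fun i => poissonMeasure (r i)) =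
      ∫ s in (0 : ℝ)..1, r j * Real.exp (-((∑ i, (r i : ℝ)) * (1 - s))) := by
  have h1 : ∀ q : Fin n → ℕ, (q j : ℝ) / ∑ i, (q i : ℝ) =
      ∫ s in Set.Ioc (0 : ℝ) 1, (q j : ℝ) * s ^ (∑ i, q i - 1) := by
    intro q
    rw [← intervalIntegral.integral_of_le zero_le_one, integral_mul_pow_sub_one _ _
      (Finset.single_le_sum (fun i _ => Nat.zero_le (q i)) (Finset.mem_univ j))]
    push_cast
    rfl
  have h2 : ∀ s : ℝ, ∫ q : Fin n → ℕ, (q j : ℝ) * s ^ (∑ i, q i - 1)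
      ∂Measure.pi (fun i => poissonMeasure (r i)) =
      r j * Real.exp (-((∑ i, (r i : ℝ)) * (1 - s))) := by
    intro s
    simp_rw [← prod_mul_pow_sub_one]
    rw [integral_fintype_prod_eq_prod
      (fun i (k : ℕ) => if i = j then (k : ℝ) * s ^ (k - 1) else s ^ k)]
    have : ∀ i, ∫ k, (if i = j then (k : ℝ) * s ^ (k - 1) else s ^ k) ∂poissonMeasure (r i) =
        (if i = j then (r i : ℝ) else 1) * Real.exp (-(r i * (1 - s))) := by
      intro i
      split_ifs
      · exact integral_poisson_mul_pow _ _
      · rw [one_mul]; exact integral_poisson_pow _ _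
    simp_rw [this]
    rw [Finset.prod_mul_distrib, Finset.prod_ite_eq' Finset.univ j, if_pos (Finset.mem_univ j),
      ← Real.exp_sum, Finset.sum_neg_distrib, Finset.sum_mul]
  simp_rw [h1]
  rw [integral_integral_swap, intervalIntegral.integral_of_le zero_le_one]
  · simp_rw [h2]
  · have hint : Integrable (fun q : Fin n → ℕ => (q j : ℝ))
        (Measure.pi fun i => poissonMeasure (r i)) :=
      integrable_comp_eval (i := j) (μ := fun i => poissonMeasure (r i)) (f := fun k : ℕ => (k : ℝ)) (integrable_natCast_poisson (r j))
    -- For Fubini: with `s` in `(0, 1]` the integrand is dominated by `q j`, which has finite mean.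
    refine (hint.comp_fst (volume.restrict (Set.Ioc (0 : ℝ) 1))).mono' ?_ ?_
    · refine Measurable.aestronglyMeasurable ?_
      exact measurable_from_prod_countable_right fun q => by
        simp only [Function.uncurry]; fun_prop
    · have hs : ∀ᵐ p ∂(Measure.pi fun i => poissonMeasure (r i)).prod
          (volume.restrict (Set.Ioc (0 : ℝ) 1)), p.2 ∈ Set.Ioc (0 : ℝ) 1 :=
        Measure.quasiMeasurePreserving_snd.ae (ae_restrict_mem measurableSet_Ioc)
      filter_upwards [hs] with p hp
      simp only [Function.uncurry, norm_mul, norm_pow, Real.norm_eq_abs, Nat.abs_cast,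
        abs_of_pos hp.1]
      exact mul_le_of_le_one_right (Nat.cast_nonneg _) (pow_le_one₀ hp.1.le hp.2)

/-- If the total rate is at most `2`, the share of `j` is at least `r j (1 - e⁻²) / 2`. -/
theorem le_integral_share_pi_poisson (r : Fin n → NNReal) (hr : ∑ i, (r i : ℝ) ≤ 2) (j : Fin n) :
    r j * ((1 - Real.exp (-2)) / 2) ≤
      ∫ q : Fin n → ℕ, (q j : ℝ) / ∑ i, (q i : ℝ) ∂Measure.pi (fun i => poissonMeasure (r i)) := by
  have h : ∫ s in (0 : ℝ)..1, Real.exp (-(2 * (1 - s))) = (1 - Real.exp (-2)) / 2 := by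
    have hderiv : ∀ s ∈ Set.uIcc (0 : ℝ) 1,
        HasDerivAt (fun s : ℝ => Real.exp (-(2 * (1 - s))) / 2) (Real.exp (-(2 * (1 - s)))) s := by
      intro s _
      have := (((((hasDerivAt_id s).const_sub 1).const_mul 2).neg).exp).div_const 2
      convert! this using 1
      simp only [Pi.neg_apply, id]
      ring
    rw [intervalIntegral.integral_eq_sub_of_hasDerivAt hderiv
      (Continuous.intervalIntegrable (by fun_prop) _ _)]
    norm_num
    ring
  rw [integral_share_pi_poisson, intervalIntegral.integral_const_mul, ← h]
  -- Comparing integrands before integrating avoids dividing by the total rate, which may be `0`.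
  refine mul_le_mul_of_nonneg_left ?_ (r j).2
  refine intervalIntegral.integral_mono_on zero_le_one
    (Continuous.intervalIntegrable (by fun_prop) _ _)
    (Continuous.intervalIntegrable (by fun_prop) _ _) fun s hs => ?_
  exact Real.exp_le_exp.2 (neg_le_neg (mul_le_mul_of_nonneg_right hr (sub_nonneg.2 hs.2)))

/-! ### The Poisson scheme -/

/-- The joint law of the counts of the Poisson scheme. -/
def countsLaw (x : Fin n → ℝ) (R : Finset (Fin n)) : Measure (Fin n → ℕ) :=
  Measure.pi fun i => if i ∈ R then countLaw (x i) else Measure.dirac 0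

/-- The point returned by the Poisson scheme on `R` when the counts are `q`. -/
def sharePoint (R : Finset (Fin n)) (q : Fin n → ℕ) : Fin n → ℝ :=
  fun i => (q i : ℝ) / ∑ j ∈ R, (q j : ℝ)

theorem measurable_sharePoint (R : Finset (Fin n)) : Measurable (sharePoint R) :=
  measurable_pi_lambda _ fun i => by unfold sharePoint; fun_prop

theorem poissonScheme_eq (x : Fin n → ℝ) (R : Finset (Fin n)) :
    poissonScheme n x R = (countsLaw x R).map (sharePoint R) := rfl

theorem isProbabilityMeasure_ite_countLaw {x : Fin n → ℝ} (hx : ∀ i, 0 ≤ x i)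
    (R : Finset (Fin n)) (i : Fin n) :
    IsProbabilityMeasure (if i ∈ R then countLaw (x i) else Measure.dirac 0) := by
  have := isProbabilityMeasure_countLaw (hx i)
  split_ifs <;> infer_instance

theorem isProbabilityMeasure_countsLaw {x : Fin n → ℝ} (hx : ∀ i, 0 ≤ x i)
    (R : Finset (Fin n)) : IsProbabilityMeasure (countsLaw x R) := by
  have := isProbabilityMeasure_ite_countLaw hx R
  unfold countsLaw
  infer_instance

theorem ae_countsLaw_eq_zero {x : Fin n → ℝ} (hx : ∀ i, 0 ≤ x i) (R : Finset (Fin n)) :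
    ∀ᵐ q ∂countsLaw x R, ∀ i ∉ R, q i = 0 := by
  have := isProbabilityMeasure_ite_countLaw hx R
  rw [ae_all_iff]
  intro i
  by_cases hi : i ∈ R
  · simp [hi]
  · refine (Measure.tendsto_eval_ae_ae (i := i)
      (μ := fun i => if i ∈ R then countLaw (x i) else Measure.dirac 0)).eventually
      (p := fun k : ℕ => i ∉ R → k = 0) ?_
    simp only [hi, if_false]
    rw [ae_dirac_eq]
    simp

theorem sharePoint_mem_Icc {R : Finset (Fin n)} {q : Fin n → ℕ} (h : ∀ i ∉ R, q i = 0)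
    (i : Fin n) : sharePoint R q i ∈ Set.Icc (0 : ℝ) 1 := by
  have h0 : ∀ j ∈ R, (0 : ℝ) ≤ q j := fun j _ => Nat.cast_nonneg _
  refine ⟨div_nonneg (Nat.cast_nonneg _) (Finset.sum_nonneg h0), ?_⟩
  by_cases hi : i ∈ R
  · exact div_le_one_of_le₀ (Finset.single_le_sum h0 hi) (Finset.sum_nonneg h0)
  · simp [sharePoint, h i hi]

theorem sum_sharePoint_le_one {R : Finset (Fin n)} {q : Fin n → ℕ} (h : ∀ i ∉ R, q i = 0) :
    ∑ i, sharePoint R q i ≤ 1 := by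
  unfold sharePoint
  rw [← Finset.sum_div, ← Finset.sum_subset (Finset.subset_univ R)
    fun i _ hi => by rw [h i hi, Nat.cast_zero]]
  exact div_self_le_one _

theorem supp_sharePoint_subset {R : Finset (Fin n)} {q : Fin n → ℕ} (h : ∀ i ∉ R, q i = 0) :
    supp (sharePoint R q) ⊆ R := by
  intro i hi
  by_contra hiR
  exact mem_supp.1 hi (by simp [sharePoint, h i hiR])

theorem isProbabilityMeasure_poissonScheme {x : Fin n → ℝ} (hx : ∀ i, 0 ≤ x i)
    (R : Finset (Fin n)) : IsProbabilityMeasure (poissonScheme n x R) := by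
  have := isProbabilityMeasure_countsLaw hx R
  rw [poissonScheme_eq]
  exact Measure.isProbabilityMeasure_map (measurable_sharePoint R).aemeasurable

theorem ae_poissonScheme {a : Fin n → ℝ} (ha : ∀ i, a i ≤ 1) {x : Fin n → ℝ} (hx : ∀ i, 0 ≤ x i)
    (R : Finset (Fin n)) :
    ∀ᵐ y ∂poissonScheme n x R, y ∈ integerHull (knapsackPolytope a) ∧ supp y ⊆ R := by
  have hmeas : MeasurableSet {y : Fin n → ℝ |
      y ∈ integerHull (knapsackPolytope a) ∧ supp y ⊆ R} := by
    have : {y : Fin n → ℝ | y ∈ integerHull (knapsackPolytope a) ∧ supp y ⊆ R} =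
        integerHull (knapsackPolytope a) ∩ ⋂ i ∈ Rᶜ, {y | y i = 0} := by
      ext y
      simp only [Set.mem_inter_iff, Set.mem_iInter, Finset.subset_iff, mem_supp,
        Finset.mem_compl, Set.mem_ofPred_eq]
      refine and_congr_right fun _ => forall_congr' fun i => ?_
      tauto
    rw [this]
    refine (isClosed_integerHull _).measurableSet.inter
      (Finset.measurableSet_biInter _ fun i _ => ?_)
    exact measurableSet_eq_fun (measurable_pi_apply i) measurable_const
  rw [poissonScheme_eq, ae_map_iff (measurable_sharePoint R).aemeasurable hmeas]
  filter_upwards [ae_countsLaw_eq_zero hx R] with q hq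
  exact ⟨mem_integerHull_of_sum_le_one ha (fun i => (sharePoint_mem_Icc hq i).1)
    (sum_sharePoint_le_one hq), supp_sharePoint_subset hq⟩

/-- The counts are drawn on `R` but normalized over `S`, as the coupling requires. The share is at
most `1` if `q j` occurs in the denominator, and is almost surely `0` if `j ∉ R`. -/
theorem integrable_sharePoint {x : Fin n → ℝ} (hx : ∀ i, 0 ≤ x i) {R S : Finset (Fin n)}
    {j : Fin n} (hj : j ∈ S ∨ j ∉ R) :
    Integrable (fun q => sharePoint S q j) (countsLaw x R) := by
  have := isProbabilityMeasure_countsLaw hx R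
  refine Integrable.of_mem_Icc 0 1
    ((measurable_pi_apply j).comp (measurable_sharePoint S)).aemeasurable ?_
  filter_upwards [ae_countsLaw_eq_zero hx R] with q hq
  have h0 : ∀ i ∈ S, (0 : ℝ) ≤ q i := fun j _ => Nat.cast_nonneg _
  rcases hj with hj | hj
  · exact ⟨div_nonneg (Nat.cast_nonneg _) (Finset.sum_nonneg h0),
      div_le_one_of_le₀ (Finset.single_le_sum h0 hj) (Finset.sum_nonneg h0)⟩
  · simp [sharePoint, hq j hj]

theorem integrable_poissonScheme {x : Fin n → ℝ} (hx : ∀ i, 0 ≤ x i) (R : Finset (Fin n))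
    (j : Fin n) : Integrable (fun y => y j) (poissonScheme n x R) := by
  rw [poissonScheme_eq, integrable_map_measure
    (measurable_pi_apply j).aestronglyMeasurable (measurable_sharePoint R).aemeasurable]
  exact integrable_sharePoint hx (em _)

theorem expectedCoord_poissonScheme (x : Fin n → ℝ) (R : Finset (Fin n)) (j : Fin n) :
    expectedCoord (poissonScheme n) x R j = ∫ q, sharePoint R q j ∂countsLaw x R := by
  rw [expectedCoord, poissonScheme_eq, integral_map (measurable_sharePoint R).aemeasurable
    (measurable_pi_apply j).aestronglyMeasurable]

theorem expectedCoord_poissonScheme_nonneg (x : Fin n → ℝ) (R : Finset (Fin n)) (j : Fin n) :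
    0 ≤ expectedCoord (poissonScheme n) x R j := by
  rw [expectedCoord_poissonScheme]
  exact integral_nonneg fun q => div_nonneg (Nat.cast_nonneg _)
    (Finset.sum_nonneg fun i _ => Nat.cast_nonneg _)

theorem expectedCoord_poissonScheme_of_notMem {x : Fin n → ℝ} (hx : ∀ i, 0 ≤ x i)
    {R : Finset (Fin n)} {j : Fin n} (hj : j ∉ R) :
    expectedCoord (poissonScheme n) x R j = 0 := by
  rw [expectedCoord_poissonScheme]
  refine integral_eq_zero_of_ae ?_
  filter_upwards [ae_countsLaw_eq_zero hx R] with q hq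
  simp [sharePoint, hq j hj]

/-- Erasing the counts of the items outside `A` turns the counts on `B ⊇ A` into those on `A`. -/
theorem map_countsLaw {x : Fin n → ℝ} (hx : ∀ i, 0 ≤ x i) {A B : Finset (Fin n)} (hAB : A ⊆ B) :
    (countsLaw x B).map (fun q i => if i ∈ A then q i else 0) = countsLaw x A := by
  have := isProbabilityMeasure_ite_countLaw hx B
  have hmap : ∀ i, ((if i ∈ B then countLaw (x i) else Measure.dirac 0).map
      fun k : ℕ => if i ∈ A then k else 0) =
      if i ∈ A then countLaw (x i) else Measure.dirac 0 := by
    intro i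
    by_cases hi : i ∈ A
    · simp only [hi, hAB hi, if_true]
      exact Measure.map_id
    · simp only [hi, if_false]
      rw [Measure.map_const, measure_univ, one_smul]
  have hfin : ∀ i, SigmaFinite ((if i ∈ B then countLaw (x i) else Measure.dirac 0).map
      fun k : ℕ => if i ∈ A then k else 0) := by
    have := isProbabilityMeasure_ite_countLaw hx A
    intro i; rw [hmap]; infer_instance
  unfold countsLaw
  rw [Measure.pi_map_pi (f := fun i (k : ℕ) => if i ∈ A then k else 0)
    fun i => Measurable.of_discrete.aemeasurable]
  simp_rw [hmap]

/-- Coupling: draw the counts once on `B` and reuse them on `A`. The numerator stays the same while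
the denominator can only shrink. -/
theorem expectedCoord_poissonScheme_anti {x : Fin n → ℝ} (hx : ∀ i, 0 ≤ x i)
    {A B : Finset (Fin n)} (hAB : A ⊆ B) {i : Fin n} (hi : i ∈ A) :
    expectedCoord (poissonScheme n) x B i ≤ expectedCoord (poissonScheme n) x A i := by
  have hA : expectedCoord (poissonScheme n) x A i = ∫ q, sharePoint A q i ∂countsLaw x B := by
    rw [expectedCoord_poissonScheme, ← map_countsLaw hx hAB, integral_map
      Measurable.of_discrete.aemeasurable
      (f := fun q => sharePoint A q i)
      ((measurable_pi_apply i).comp (measurable_sharePoint A)).aestronglyMeasurable]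
    refine integral_congr_ae (Filter.Eventually.of_forall fun q => ?_)
    simp only [sharePoint, hi, if_true]
    congr 1
    exact Finset.sum_congr rfl fun k hk => by rw [if_pos hk]
  rw [hA, expectedCoord_poissonScheme]
  refine integral_mono (integrable_sharePoint hx (em _))
    (integrable_sharePoint hx (Or.inl hi)) fun q => ?_
  have hle : ∑ k ∈ A, (q k : ℝ) ≤ ∑ k ∈ B, (q k : ℝ) :=
    Finset.sum_le_sum_of_subset_of_nonneg hAB fun k _ _ => Nat.cast_nonneg _
  have hqA : (q i : ℝ) ≤ ∑ k ∈ A, (q k : ℝ) :=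
    Finset.single_le_sum (f := fun k => (q k : ℝ)) (fun k _ => Nat.cast_nonneg _) hi
  rcases Nat.eq_zero_or_pos (q i) with h | h
  · simp [sharePoint, h]
  · have : (0 : ℝ) < q i := by exact_mod_cast h
    exact div_le_div_of_nonneg_left this.le (by linarith) hle

theorem expectedCoord_poissonScheme_eq_univ {x : Fin n → ℝ} (hx : ∀ i, 0 ≤ x i)
    (R : Finset (Fin n)) (j : Fin n) : expectedCoord (poissonScheme n) x R j =
      ∫ q : Fin n → ℕ, (q j : ℝ) / ∑ i, (q i : ℝ) ∂countsLaw x R := by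
  rw [expectedCoord_poissonScheme]
  refine integral_congr_ae ?_
  filter_upwards [ae_countsLaw_eq_zero hx R] with q hq
  rw [sharePoint, Finset.sum_subset (Finset.subset_univ R)
    fun i _ hi => by rw [hq i hi, Nat.cast_zero]]

/-- Running the Poisson scheme on the sampled part of `S` amounts to drawing independent Poisson
counts for the items of `S`. -/
theorem sum_sampleProb_mul_expectedCoord_poissonScheme {x : Fin n → ℝ}
    (hx : ∀ i, 0 ≤ x i ∧ x i ≤ 1) (S : Finset (Fin n)) (j : Fin n) :
    ∑ R, sampleProb x R * expectedCoord (poissonScheme n) x (R ∩ S) j =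
      ∫ q : Fin n → ℕ, (q j : ℝ) / ∑ i, (q i : ℝ)
        ∂Measure.pi fun i => poissonMeasure (if i ∈ S then (x i).toNNReal else 0) := by
  have h1 := isProbabilityMeasure_ite_countLaw (fun i => (hx i).1) S
  have h2 : ∀ _ : Fin n, IsProbabilityMeasure (Measure.dirac (0 : ℕ)) := inferInstance
  have hmix := sum_sampleProb_smul_pi hx
    (fun i => if i ∈ S then countLaw (x i) else Measure.dirac 0) (fun _ => Measure.dirac 0)
  have hL : ∀ R : Finset (Fin n), Measure.pi (fun i => if i ∈ R then
      (if i ∈ S then countLaw (x i) else Measure.dirac 0) else Measure.dirac 0) =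
      countsLaw x (R ∩ S) := by
    intro R
    simp only [countsLaw, Finset.mem_inter, ite_and]
  have hR : ∀ i, ENNReal.ofReal (x i) • (if i ∈ S then countLaw (x i) else Measure.dirac 0) +
      ENNReal.ofReal (1 - x i) • Measure.dirac 0 =
      poissonMeasure (if i ∈ S then (x i).toNNReal else 0) := by
    intro i
    split_ifs
    · exact smul_countLaw_add_smul_dirac (hx i).1 (hx i).2
    -- Outside `S` the count is always `0`, which is the Poisson law of rate `0`.
    · rw [← add_smul, ← ENNReal.ofReal_add (hx i).1 (sub_nonneg.2 (hx i).2)]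
      have := smul_countLaw_add_smul_dirac le_rfl zero_le_one
      simpa [countLaw_zero] using this
  simp_rw [hL, hR] at hmix
  rw [← hmix, integral_finsetSum_measure]
  · refine Finset.sum_congr rfl fun R _ => ?_
    rw [integral_smul_measure, ENNReal.toReal_ofReal (sampleProb_nonneg hx R), smul_eq_mul,
      expectedCoord_poissonScheme_eq_univ fun i => (hx i).1]
  · intro R _
    refine Integrable.smul_measure ?_ ENNReal.ofReal_ne_top
    refine (integrable_sharePoint (fun i => (hx i).1) (em (j ∈ R ∩ S))).congr ?_
    filter_upwards [ae_countsLaw_eq_zero (fun i => (hx i).1) (R ∩ S)] with q hq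
    rw [sharePoint, Finset.sum_subset (Finset.subset_univ (R ∩ S))
      fun i _ hi => by rw [hq i hi, Nat.cast_zero]]

/-- Intersecting with a fixed set of items is the form needed for Poisson thinning. -/
theorem bigItems_eq_inter (a : Fin n → ℝ) (R : Finset (Fin n)) :
    bigItems a R = R ∩ bigItems a Finset.univ := by
  ext i; simp [bigItems]

theorem bigItems_subset (a : Fin n → ℝ) (R : Finset (Fin n)) : bigItems a R ⊆ R :=
  Finset.filter_subset _ _

/-- The fractional number of big items is at most `2`. -/
theorem sum_bigItems_le_two {a x : Fin n → ℝ} (ha : ∀ i, 0 ≤ a i) (hx : x ∈ knapsackPolytope a) :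
    ∑ i ∈ bigItems a Finset.univ, x i ≤ 2 := by
  have h1 : ∑ i ∈ bigItems a Finset.univ, x i ≤ ∑ i ∈ bigItems a Finset.univ, 2 * (a i * x i) := by
    refine Finset.sum_le_sum fun i hi => ?_
    have := (Finset.mem_filter.1 hi).2.1
    nlinarith [(hx.1 i).1]
  have h2 : ∑ i ∈ bigItems a Finset.univ, a i * x i ≤ ∑ i, a i * x i :=
    Finset.sum_le_sum_of_subset_of_nonneg (Finset.subset_univ _)
      fun i _ _ => mul_nonneg (ha i) (hx.1 i).1
  rw [← Finset.mul_sum] at h1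
  linarith [hx.2]

theorem le_sum_poissonScheme_bigItems {a x : Fin n → ℝ} (ha : ∀ i, 0 ≤ a i ∧ a i ≤ 1)
    (hx : x ∈ knapsackPolytope a) {j : Fin n} (hj : 1 / 2 < a j) :
    (1 - Real.exp (-2)) / 2 * x j ≤
      ∑ R with j ∈ R, sampleProb x R * expectedCoord (poissonScheme n) x (bigItems a R) j := by
  have hbig : j ∈ bigItems a Finset.univ := 
    Finset.mem_filter.2 ⟨Finset.mem_univ j, hj, (ha j).2⟩
  have h := le_integral_share_pi_poisson
    (fun i => if i ∈ bigItems a Finset.univ then (x i).toNNReal else 0) ?_ j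
  · rw [← sum_sampleProb_mul_expectedCoord_poissonScheme hx.1, if_pos hbig,
      Real.coe_toNNReal _ (hx.1 j).1, mul_comm] at h
    simp_rw [← bigItems_eq_inter] at h
    -- Sets `R` not containing `j` contribute nothing, so the sum over all `R` reduces to those with
    -- `j ∈ R`.
    refine h.trans_eq (Finset.sum_filter_of_ne fun R _ hne => ?_).symm
    by_contra hjR
    rw [expectedCoord_poissonScheme_of_notMem (fun i => (hx.1 i).1)
      fun hmem => hjR (bigItems_subset a R hmem), mul_zero] at hne
    exact hne rfl
  · refine le_trans (le_of_eq ?_) (sum_bigItems_le_two (fun i => (ha i).1) hx)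
    rw [← Finset.sum_filter_add_sum_filter_not Finset.univ (· ∈ bigItems a Finset.univ),
      Finset.sum_eq_zero (s := Finset.univ.filter (· ∉ bigItems a Finset.univ))
        fun i hi => by rw [if_neg (Finset.mem_filter.1 hi).2, NNReal.coe_zero], add_zero,
      Finset.filter_mem_eq_inter, Finset.univ_inter]
    exact Finset.sum_congr rfl fun i hi => by rw [if_pos hi, Real.coe_toNNReal _ (hx.1 i).1]

/-! ### The mixed scheme -/

theorem expectedCoord_mixedScheme {q : ℝ} (hq : q ∈ Set.Icc (0 : ℝ) 1) (a : Fin n → ℝ)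
    {x : Fin n → ℝ} (hx : ∀ i, 0 ≤ x i) (R : Finset (Fin n)) (j : Fin n) :
    expectedCoord (mixedScheme q a) x R j = q * expectedCoord (generalScheme a) x R j +
      (1 - q) * expectedCoord (poissonScheme n) x (bigItems a R) j := by
  have h1 : Integrable (fun y : Fin n → ℝ => y j) (generalScheme a x R) :=
    integrable_dirac (by simp)
  rw [expectedCoord, mixedScheme, integral_add_measure
    (h1.smul_measure ENNReal.ofReal_ne_top)
    ((integrable_poissonScheme hx _ j).smul_measure ENNReal.ofReal_ne_top),
    integral_smul_measure, integral_smul_measure, ENNReal.toReal_ofReal hq.1,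
    ENNReal.toReal_ofReal (sub_nonneg.2 hq.2)]
  rfl

theorem isCRS_mixedScheme {q : ℝ} (hq : q ∈ Set.Icc (0 : ℝ) 1) {a : Fin n → ℝ}
    (ha : ∀ i, 0 ≤ a i ∧ a i ≤ 1) : IsCRS (knapsackPolytope a) (mixedScheme q a) := by
  intro x hx R _
  have h1 := isProbabilityMeasure_poissonScheme (fun i => (hx.1 i).1) (bigItems a R)
  have h2 : IsProbabilityMeasure (generalScheme a x R) := Measure.dirac.isProbabilityMeasure
  refine ⟨isProbabilityMeasure_mix hq _ _, ?_⟩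
  rw [mixedScheme, ae_add_measure_iff]
  refine ⟨Measure.ae_smul_measure ?_ _, Measure.ae_smul_measure ?_ _⟩
  · rw [generalScheme, ae_dirac_eq]
    exact ⟨generalPoint_mem_integerHull ha R, supp_generalPoint a R⟩
  · filter_upwards [ae_poissonScheme (fun i => (ha i).2) (fun i => (hx.1 i).1) (bigItems a R)]
      with y hy
    exact ⟨hy.1, hy.2.trans (bigItems_subset a R)⟩

theorem isMonotone_mixedScheme {q : ℝ} (hq : q ∈ Set.Icc (0 : ℝ) 1) {a : Fin n → ℝ}
    (ha : ∀ i, 0 ≤ a i ∧ a i ≤ 1) : IsMonotone (knapsackPolytope a) (mixedScheme q a) := by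
  intro x hx A B hAB _ i hi
  have hx0 : ∀ i, 0 ≤ x i := fun i => (hx.1 i).1
  rw [expectedCoord_mixedScheme hq a hx0, expectedCoord_mixedScheme hq a hx0,
    expectedCoord_generalScheme, expectedCoord_generalScheme]
  refine add_le_add
    (mul_le_mul_of_nonneg_left (generalPoint_anti (fun i => (ha i).1) hAB hi) hq.1)
    (mul_le_mul_of_nonneg_left ?_ (sub_nonneg.2 hq.2))
  -- Being big depends only on the item, so a small `i` gets `0` from the Poisson part on both sets.
  by_cases hbig : i ∈ bigItems a A
  · exact expectedCoord_poissonScheme_anti hx0 (Finset.filter_subset_filter _ hAB) hbig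
  · have hB : i ∉ bigItems a B := fun h =>
      hbig (Finset.mem_filter.2 ⟨hi, (Finset.mem_filter.1 h).2⟩)
    rw [expectedCoord_poissonScheme_of_notMem hx0 hB,
      expectedCoord_poissonScheme_of_notMem hx0 hbig]

theorem isBalanced_mixedScheme {a : Fin n → ℝ} (ha : ∀ i, 0 ≤ a i ∧ a i ≤ 1) :
    IsBalanced (knapsackPolytope a) (mixedScheme mixProb a) mixBalance := by
  intro x hx j hj
  have hx0 : ∀ i, 0 ≤ x i := fun i => (hx.1 i).1
  have ha0 : ∀ i, 0 ≤ a i := fun i => (ha i).1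
  have hq0 : 0 ≤ mixProb := mixProb_pos.le
  have hq1 : 0 ≤ 1 - mixProb := sub_nonneg.2 mixProb_lt_one.le
  rw [le_condExpectedCoord_iff ((hx0 j).lt_of_ne (Ne.symm (mem_supp.1 hj)))]
  simp_rw [expectedCoord_mixedScheme ⟨hq0, mixProb_lt_one.le⟩ a hx0, mul_add,
    mul_left_comm (sampleProb x _)]
  rw [Finset.sum_add_distrib, ← Finset.mul_sum, ← Finset.mul_sum]
  by_cases hbig : 1 / 2 < a j
  -- Here `a j ≤ 1` allows `c = 2`, so the general scheme contributes `1/4`.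
  · have h1 := mul_le_mul_of_nonneg_left (half_inv_mul_le_sum_generalScheme ha0 hx j
      (c := 2) (by norm_num) (by linarith [(ha j).2])) hq0
    have h2 := mul_le_mul_of_nonneg_left (le_sum_poissonScheme_bigItems ha hx hbig) hq1
    rw [mixBalance_eq']
    norm_num at h1
    linarith
  -- Here `a j ≤ 1/2` allows `c = 3/2`; the resulting `1/3` suffices, and the Poisson part only
  -- needs to be nonnegative.
  · have h1 := mul_le_mul_of_nonneg_left (half_inv_mul_le_sum_generalScheme ha0 hx j
      (c := 3 / 2) (by norm_num) (by linarith)) hq0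
    have h2 : 0 ≤ (1 - mixProb) * ∑ R with j ∈ R,
        sampleProb x R * expectedCoord (poissonScheme n) x (bigItems a R) j :=
      mul_nonneg hq1 (Finset.sum_nonneg fun R _ => mul_nonneg (sampleProb_nonneg hx.1 R)
        (expectedCoord_poissonScheme_nonneg _ _ _))
    rw [mixBalance_eq]
    norm_num at h1
    linarith

theorem one_third_le_condExpectedCoord_generalScheme {a x : Fin n → ℝ} (ha : ∀ i, 0 ≤ a i)
    (hx : x ∈ knapsackPolytope a) {j : Fin n} (hj : j ∈ supp x) (haj : a j ≤ 1 / 2) :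
    1 / 3 ≤ condExpectedCoord (generalScheme a) x j := by
  rw [le_condExpectedCoord_iff ((hx.1 j).1.lt_of_ne (Ne.symm (mem_supp.1 hj)))]
  convert half_inv_mul_le_sum_generalScheme ha hx j (c := 3 / 2) (by norm_num)
    (by linarith) using 2
  norm_num

end ContentionResolution

end

theorem mainTheorem5 :
    -- the constants
    (0 < ContentionResolution.mixProb ∧ ContentionResolution.mixProb < 1 ∧
      (0.279 : ℝ) ≤ ContentionResolution.mixBalance) ∧
    ∀ (n : ℕ) (a : Fin n → ℝ), (∀ i, 0 ≤ a i ∧ a i ≤ 1) →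
      -- existence of a monotone 0.279-balanced scheme
      (∃ π : ContentionResolution.Scheme n,
        ContentionResolution.IsCRS (ContentionResolution.knapsackPolytope a) π ∧
        ContentionResolution.IsMonotone (ContentionResolution.knapsackPolytope a) π ∧
        ContentionResolution.IsBalanced (ContentionResolution.knapsackPolytope a) π 0.279) ∧
      -- the mixed scheme is such a scheme, with the explicit constant
      (ContentionResolution.IsCRS (ContentionResolution.knapsackPolytope a)
          (ContentionResolution.mixedScheme ContentionResolution.mixProb a) ∧
        ContentionResolution.IsMonotone (ContentionResolution.knapsackPolytope a)
          (ContentionResolution.mixedScheme ContentionResolution.mixProb a) ∧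
        ContentionResolution.IsBalanced (ContentionResolution.knapsackPolytope a)
          (ContentionResolution.mixedScheme ContentionResolution.mixProb a)
          ContentionResolution.mixBalance) ∧
      -- the bound of the general scheme for the items of size at most 1/2
      (∀ x ∈ ContentionResolution.knapsackPolytope a, ∀ j ∈ ContentionResolution.supp x,
        a j ≤ 1 / 2 →
        1 / 3 ≤ ContentionResolution.condExpectedCoord
          (ContentionResolution.generalScheme a) x j) := by
  refine ⟨⟨ContentionResolution.mixProb_pos, ContentionResolution.mixProb_lt_one,
    ContentionResolution.le_mixBalance⟩, fun n a ha => ?_⟩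
  have hq : ContentionResolution.mixProb ∈ Set.Icc (0 : ℝ) 1 :=
    ⟨ContentionResolution.mixProb_pos.le, ContentionResolution.mixProb_lt_one.le⟩
  have hC := ContentionResolution.isCRS_mixedScheme hq ha
  have hM := ContentionResolution.isMonotone_mixedScheme hq ha
  have hB := ContentionResolution.isBalanced_mixedScheme ha
  exact ⟨⟨_, hC, hM, fun x hx j hj => ContentionResolution.le_mixBalance.trans (hB x hx j hj)⟩,
    ⟨hC, hM, hB⟩, fun x hx j hj haj =>
      ContentionResolution.one_third_le_condExpectedCoord_generalScheme (fun i => (ha i).1)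
        hx hj haj⟩
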